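/- Let $n\ge 2$. For a bounded set $\mathscr M\subset M_n(\mathbb R)$ of real $n\times n$ matrices consider the linear switched system $$\dot x(t)=A(t)x(t),\qquad t\ge 0,\ x(t)\in\mathbb R^n,\qquad(\Sigma_{\mathscr M})$$ where the switching law $A:[0,\infty)\to\mathscr M$ is an arbitrary measurable function, and let $\Phi_A(t,0)$ be its fundamental matrix, so that the solutions (locally absolutely continuous functions satisfying the equation for almost every $t$) are $x(t)=\Phi_A(t,0)x(0)$. The system $(\Sigma_{\mathscr M})$ is uniformly exponentially stable if there are $C,\gamma>0$ such that $\|\Phi_A(t,0)\|\le Ce^{-\gamma t}$ for every switching law $A$ and every $t\ge 0$. A common Lyapunov function for $(\Sigma_{\mathscr M})$ is a continuous function $V:\mathbb R^n\to\mathbb R$ with $V(0)=0$ and $V(x)>0$ for all $x\ne 0$ such that $t\mapsto V(x(t))$ is strictly decreasing on $[0,\infty)$ along every nonzero solution $x$ of $(\Sigma_{\mathscr M})$. A set $\mathcal P$ of functions from $\mathbb R^n$ to $\mathbb R$ is a universal class of Lyapunov functions if for every bounded $\mathscr M\subset M_n(\mathbb R)$ such that $(\Sigma_{\mathscr M})$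 is uniformly exponentially stable, $\mathcal P$ contains a common Lyapunov function for $(\Sigma_{\mathscr M})$. Theorem. Let $\mathcal P$ be a compact subset of the space of real-analytic functions from $\mathbb R^n$ to $\mathbb R$, endowed with the topology of uniform convergence on bounded sets, and assume that $\mathcal P$ does not contain the zero function. Then $\mathcal P$ is not a universal class of Lyapunov functions. -/

import Mathlib

namespace SwitchedSystem

/-- The state space `ℝⁿ` with its Euclidean norm. -/
abbrev State (n : ℕ) : Type := EuclideanSpace ℝ (Fin n)

/-- The linear map `x ↦ M x` of `ℝⁿ` given by an `n × n` matrix `M`; its norm is the operator norm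
induced by the Euclidean norm. -/
noncomputable abbrev act {n : ℕ} (M : Matrix (Fin n) (Fin n) ℝ) : State n →L[ℝ] State n :=
  Matrix.toEuclideanCLM (𝕜 := ℝ) M

/-- A set of matrices is bounded. -/
def IsBoundedSet {n : ℕ} (𝓜 : Set (Matrix (Fin n) (Fin n) ℝ)) : Prop :=
  ∃ K : ℝ, ∀ M ∈ 𝓜, ‖act M‖ ≤ K

/-- Arbitrary switching laws: measurable functions `[0, ∞) → 𝓜`. (The values at negative times are
never used; any measurable function on `[0, ∞)` extends measurably to `ℝ`.) -/
structure IsSwitchingLaw {n : ℕ} (𝓜 : Set (Matrix (Fin n) (Fin n) ℝ))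
    (A : ℝ → Matrix (Fin n) (Fin n) ℝ) : Prop where
  measurable_entry : ∀ i j, Measurable fun t => A t i j
  mem : ∀ t, 0 ≤ t → A t ∈ 𝓜

/-- `x` is a (Carathéodory) solution on `[0, ∞)` of `x' (t) = A (t) x (t)`, i.e. a continuous
solution of the integral equation. For `A` measurable and bounded this means: `x` is locally
absolutely continuous and satisfies the differential equation for almost every `t ≥ 0`. -/
structure IsSolution {n : ℕ} (A : ℝ → Matrix (Fin n) (Fin n) ℝ) (x : ℝ → State n) : Prop where
  continuousOn : ContinuousOn x (Set.Ici 0)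
  integral_eq : ∀ t, 0 ≤ t → x t = x 0 + ∫ s in (0 : ℝ)..t, act (A s) (x s)

/-- `Φ t` is the fundamental matrix `Φ_A (t, 0)`, `t ≥ 0`, of `x' (t) = A (t) x (t)`: it is the
identity at `t = 0`, and `t ↦ Φ t x₀` is a solution for every `x₀`. For `A` measurable and bounded
there is exactly one such `Φ` on `[0, ∞)`. -/
structure IsFundamentalMatrix {n : ℕ} (A Φ : ℝ → Matrix (Fin n) (Fin n) ℝ) : Prop where
  zero_eq : Φ 0 = 1
  isSolution : ∀ x₀ : State n, IsSolution A fun t => act (Φ t) x₀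

/-- Uniform exponential stability of the switched system `x' = A (t) x`, `A (t) ∈ 𝓜`. -/
def UniformlyExponentiallyStable {n : ℕ} (𝓜 : Set (Matrix (Fin n) (Fin n) ℝ)) : Prop :=
  ∃ C γ : ℝ, 0 < C ∧ 0 < γ ∧ ∀ A Φ : ℝ → Matrix (Fin n) (Fin n) ℝ,
    IsSwitchingLaw 𝓜 A → IsFundamentalMatrix A Φ →
      ∀ t, 0 ≤ t → ‖act (Φ t)‖ ≤ C * Real.exp (-γ * t)

/-- `V` is a (strict) common Lyapunov function for the switched system given by `𝓜`: continuous,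
positive definite, and strictly decreasing along every nonzero trajectory. -/
structure IsCommonLyapunov {n : ℕ} (𝓜 : Set (Matrix (Fin n) (Fin n) ℝ)) (V : State n → ℝ) :
    Prop where
  continuous : Continuous V
  map_zero : V 0 = 0
  pos : ∀ x, x ≠ 0 → 0 < V x
  strictAntiOn : ∀ (A : ℝ → Matrix (Fin n) (Fin n) ℝ) (x : ℝ → State n),
    IsSwitchingLaw 𝓜 A → IsSolution A x → (∃ t, 0 ≤ t ∧ x t ≠ 0) →
      StrictAntiOn (fun t => V (x t)) (Set.Ici 0)

/-- `P` is a universal class of Lyapunov functions: every uniformly exponentially stable switched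
system with a bounded set of modes has a common Lyapunov function in `P`. -/
def IsUniversalClass {n : ℕ} (P : Set (State n → ℝ)) : Prop :=
  ∀ 𝓜 : Set (Matrix (Fin n) (Fin n) ℝ), IsBoundedSet 𝓜 → UniformlyExponentiallyStable 𝓜 →
    ∃ V ∈ P, IsCommonLyapunov 𝓜 V

/-- `P` is compact for the topology of uniform convergence on bounded sets. -/
def IsCompactFamily {n : ℕ} (P : Set (State n → ℝ)) : Prop :=
  IsCompact (UniformOnFun.ofFun {S : Set (State n) | Bornology.IsBounded S} '' P)

end SwitchedSystem

namespace SwitchedSystem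

open MeasureTheory Filter Topology

/-! For `ε > 0` the modes `pullModes n ε` contract the sup norm at rate `ε`, so a universal class
supplies a Lyapunov function for each `ε = 1/(k+1)`. By compactness these accumulate at some `V ∈ P`
that is nonincreasing along the flows with `ε = 0` (`exists_limit_of_isUniversalClass`). Those flows
only preserve the cube: they move `x_j` towards `±x_i`, and such moves run in a cycle through the
corners of a square. So `V` is constant on the cycle and does not depend on `x_j` where `|x_j| ≤
x_i` (`setCoord_eq_of_abs_le`). Analyticity extends this to all of `ℝⁿ`; as it holds for every `j`,
`V = V 0 = 0`, which `P` excludes. -/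

/-- The elementary matrix with `x_j' = σ x_i - x_j`, shifted by `-ε`. -/
noncomputable def pullMatrix {n : ℕ} (ε : ℝ) (i j : Fin n) (σ : ℤˣ) :
    Matrix (Fin n) (Fin n) ℝ :=
  Matrix.single j i ((σ : ℤ) : ℝ) - Matrix.single j j 1 - ε • 1

/-- All the matrices `pullMatrix ε i j σ` for a fixed shift `ε`. -/
def pullModes (n : ℕ) (ε : ℝ) : Set (Matrix (Fin n) (Fin n) ℝ) :=
  Set.range fun p : Fin n × Fin n × ℤˣ => pullMatrix ε p.1 p.2.1 p.2.2

theorem pullMatrix_mulVec {n : ℕ} (ε : ℝ) (i j : Fin n) (σ : ℤˣ) (v : Fin n → ℝ) :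
    (pullMatrix ε i j σ).mulVec v =
      Function.update v j (((σ : ℤ) : ℝ) * v i) - (1 + ε) • v := by
  ext k
  by_cases h : k = j
  · subst h
    simp [pullMatrix, Matrix.sub_mulVec, Matrix.smul_mulVec, Matrix.single_mulVec]
    ring
  · simp [pullMatrix, Matrix.sub_mulVec, Matrix.smul_mulVec, Matrix.single_mulVec, h]
    ring

theorem isBoundedSet_pullModes (n : ℕ) (ε : ℝ) : IsBoundedSet (pullModes n ε) := by
  have hfin : (pullModes n ε).Finite := Set.finite_range _
  obtain ⟨K, hK⟩ := (hfin.image fun M => ‖act M‖).bddAbove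
  exact ⟨K, fun M hM => hK ⟨M, hM, rfl⟩⟩

/-- Adding `1 + ε` times the identity leaves the map that overwrites `v j` by `±v i`, which cannot
increase the sup norm. -/
theorem norm_mulVec_add_smul_le {n : ℕ} {ε : ℝ} {M : Matrix (Fin n) (Fin n) ℝ}
    (hM : M ∈ pullModes n ε) (v : Fin n → ℝ) :
    ‖M.mulVec v + (1 + ε) • v‖ ≤ 1 * ‖v‖ := by
  obtain ⟨⟨i, j, σ⟩, rfl⟩ := hM
  simp only [pullMatrix_mulVec, sub_add_cancel, one_mul]
  refine (pi_norm_le_iff_of_nonneg (norm_nonneg v)).2 fun k => ?_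
  by_cases h : k = j
  · subst h
    rcases Int.units_eq_one_or σ with rfl | rfl <;> simpa using norm_le_pi_norm v i
  · simpa [h] using norm_le_pi_norm v k

/-! ### Uniform exponential decay for positive shift -/

/-- A continuous curve whose derivative `g` satisfies `‖g + a y‖ ≤ b ‖y‖` decays at rate `a - b`. -/
theorem norm_le_of_integral_eq {E : Type*} [NormedAddCommGroup E] [NormedSpace ℝ E]
    [CompleteSpace E] {y g : ℝ → E} {a b T : ℝ} (ha : 0 ≤ a) (hb : 0 ≤ b) (hT : 0 ≤ T)
    (hy : ContinuousOn y (Set.Icc 0 T)) (hg : IntervalIntegrable g volume 0 T)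
    (hyg : ∀ t ∈ Set.Icc 0 T, y t = y 0 + ∫ s in (0 : ℝ)..t, g s)
    (hbound : ∀ t ∈ Set.Icc 0 T, ‖g t + a • y t‖ ≤ b * ‖y t‖) :
    ‖y T‖ ≤ ‖y 0‖ * Real.exp ((b - a) * T) := by
  -- `y` need not be differentiable everywhere, so Grönwall is applied to right difference quotients
  -- of the norm.
  have key := le_gronwallBound_of_liminf_deriv_right_le (f := fun t => ‖y t‖)
    (f' := fun t => (b - a) * ‖y t‖) (δ := ‖y 0‖) (K := b - a) (ε := 0) (a := 0) (b := T)
    hy.norm ?_ le_rfl (fun _ _ => by simp) T ⟨hT, le_rfl⟩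
  · simpa [gronwallBound_ε0] using key
  intro s hs r hr
  obtain ⟨δ, hδ, hδr⟩ : ∃ δ > 0, (b - a) * ‖y s‖ + (a + b) * δ < r := by
    refine ⟨(r - (b - a) * ‖y s‖) / (a + b + 1), by apply div_pos <;> linarith, ?_⟩
    have h1 : (a + b) * ((r - (b - a) * ‖y s‖) / (a + b + 1)) < r - (b - a) * ‖y s‖ := by
      rw [mul_div_assoc', div_lt_iff₀ (by linarith)]
      nlinarith
    linarith
  obtain ⟨η, hη, hclose⟩ := Metric.continuousWithinAt_iff.1 (hy s ⟨hs.1, hs.2.le⟩) δ hδ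
  refine Eventually.frequently ?_
  -- The bound `1 / (a + 1)` keeps the factor `1 - a * (z - s)` nonnegative.
  have hη' : 0 < min (min η (1 / (a + 1))) (T - s) :=
    lt_min (lt_min hη (by positivity)) (by linarith [hs.2])
  filter_upwards [Ioo_mem_nhdsGT (show s < s + min (min η (1 / (a + 1))) (T - s) by linarith)]
    with z hz
  have hz1 : s < z := hz.1
  have hm1 := min_le_left (min η (1 / (a + 1))) (T - s)
  have hm2 := min_le_right (min η (1 / (a + 1))) (T - s)
  have hm3 := min_le_left η (1 / (a + 1))
  have hm4 := min_le_right η (1 / (a + 1))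
  have hzη : z - s < η := by linarith [hz.2]
  have hzT : z < T := by linarith [hz.2]
  have hza : a * (z - s) ≤ 1 := by
    have h1 : z - s ≤ 1 / (a + 1) := by linarith [hz.2]
    rw [le_div_iff₀ (by linarith)] at h1
    nlinarith
  have hsub : ∀ u v, 0 ≤ u → u ≤ v → v ≤ T → IntervalIntegrable g volume u v := by
    intro u v hu huv hv
    refine hg.mono_set ?_
    rw [Set.uIcc_of_le huv, Set.uIcc_of_le hT]
    exact Set.Icc_subset_Icc hu hv
  have hint : y z - (1 - a * (z - s)) • y s = ∫ t in s..z, (g t + a • y s) := by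
    rw [intervalIntegral.integral_add (hsub s z hs.1 hz1.le hzT.le) (by simp),
      intervalIntegral.integral_const, hyg z ⟨hs.1.trans hz1.le, hzT.le⟩,
      ← intervalIntegral.integral_add_adjacent_intervals (hsub 0 s le_rfl hs.1 hs.2.le)
        (hsub s z hs.1 hz1.le hzT.le), ← add_assoc, ← hyg s ⟨hs.1, hs.2.le⟩]
    module
  have hle : ‖∫ t in s..z, (g t + a • y s)‖ ≤ (b * (‖y s‖ + δ) + a * δ) * |z - s| := by
    refine intervalIntegral.norm_integral_le_of_norm_le_const fun t ht => ?_
    rw [Set.uIoc_of_le hz1.le] at ht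
    have htm : t ∈ Set.Icc 0 T := ⟨hs.1.trans ht.1.le, ht.2.trans hzT.le⟩
    have hd : dist (y t) (y s) < δ := hclose htm (by
      rw [Real.dist_eq, abs_of_pos (sub_pos.2 ht.1)]
      linarith [ht.2])
    rw [dist_eq_norm] at hd
    have hn : ‖y t‖ ≤ ‖y s‖ + δ := by
      linarith [norm_sub_norm_le (y t) (y s)]
    calc ‖g t + a • y s‖ = ‖(g t + a • y t) - a • (y t - y s)‖ := by congr 1; module
      _ ≤ ‖g t + a • y t‖ + ‖a • (y t - y s)‖ := norm_sub_le _ _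
      _ ≤ b * (‖y s‖ + δ) + a * δ := by
        rw [norm_smul, Real.norm_of_nonneg ha]
        gcongr
        exact (hbound t htm).trans (by gcongr)
  rw [← hint, abs_of_pos (sub_pos.2 hz1)] at hle
  have hfin : ‖y z‖ ≤ (b * (‖y s‖ + δ) + a * δ) * (z - s) + (1 - a * (z - s)) * ‖y s‖ := by
    have h1 := norm_sub_norm_le (y z) ((1 - a * (z - s)) • y s)
    rw [norm_smul, Real.norm_of_nonneg (by linarith : 0 ≤ 1 - a * (z - s))] at h1
    linarith
  rw [inv_mul_lt_iff₀ (sub_pos.2 hz1)]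
  have := mul_lt_mul_of_pos_left hδr (sub_pos.2 hz1)
  nlinarith

theorem intervalIntegrable_mulVec {n : ℕ} {𝓜 : Set (Matrix (Fin n) (Fin n) ℝ)}
    (h𝓜 : IsBoundedSet 𝓜) {A : ℝ → Matrix (Fin n) (Fin n) ℝ} (hA : IsSwitchingLaw 𝓜 A)
    {x : ℝ → State n} (hx : ContinuousOn x (Set.Ici 0)) {T : ℝ} (hT : 0 ≤ T) :
    IntervalIntegrable (fun s => act (A s) (x s)) volume 0 T := by
  obtain ⟨K, hK⟩ := h𝓜
  have hxT : ContinuousOn x (Set.Icc 0 T) := hx.mono Set.Icc_subset_Ici_self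
  obtain ⟨C, hC⟩ := isCompact_Icc.exists_bound_of_continuousOn hxT
  rw [intervalIntegrable_iff_integrableOn_Icc_of_le hT]
  have hmeas : AEMeasurable (fun s => (A s).mulVec (x s).ofLp)
      (volume.restrict (Set.Icc 0 T)) := by
    refine aemeasurable_pi_iff.2 fun k => ?_
    simp only [Matrix.mulVec, dotProduct]
    refine Finset.aemeasurable_fun_sum _ fun l _ => ?_
    refine (hA.measurable_entry k l).aemeasurable.mul ?_
    have hc : ContinuousOn (fun s => (x s).ofLp l) (Set.Icc 0 T) := by fun_prop
    exact hc.aemeasurable measurableSet_Icc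
  have hmeas' : AEStronglyMeasurable (fun s => act (A s) (x s))
      (volume.restrict (Set.Icc 0 T)) := by
    have h1 := (EuclideanSpace.equiv (Fin n) ℝ).symm.continuous.comp_aestronglyMeasurable
      hmeas.aestronglyMeasurable
    refine h1.congr (Eventually.of_forall fun s => ?_)
    ext k
    simp
  refine Integrable.of_bound hmeas' (K * C) ?_
  refine (ae_restrict_iff' measurableSet_Icc).2 (Eventually.of_forall fun s hs => ?_)
  have hKs := hK _ (hA.mem s hs.1)
  exact ((act (A s)).le_opNorm (x s)).trans
    (mul_le_mul hKs (hC s hs) (norm_nonneg _) ((norm_nonneg _).trans hKs))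

/-- Solutions of the shifted system decay in the supremum norm. -/
theorem norm_ofLp_le_of_isSolution {n : ℕ} {ε : ℝ} (hε : 0 ≤ ε)
    {A : ℝ → Matrix (Fin n) (Fin n) ℝ} (hA : IsSwitchingLaw (pullModes n ε) A)
    {x : ℝ → State n} (hx : IsSolution A x) {T : ℝ} (hT : 0 ≤ T) :
    ‖(x T).ofLp‖ ≤ ‖(x 0).ofLp‖ * Real.exp (-ε * T) := by
  have hi := fun t (ht : 0 ≤ t) =>
    intervalIntegrable_mulVec (isBoundedSet_pullModes n ε) hA hx.continuousOn (T := t) ht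
  let L : State n →L[ℝ] (Fin n → ℝ) := (EuclideanSpace.equiv (Fin n) ℝ).toContinuousLinearMap
  have h := norm_le_of_integral_eq (y := fun t => L (x t))
    (g := fun t => L (act (A t) (x t))) (a := 1 + ε) (b := 1) (by linarith) zero_le_one hT
    (L.continuous.comp_continuousOn (hx.continuousOn.mono Set.Icc_subset_Ici_self))
    ?_ ?_ ?_
  · have he : 1 - (1 + ε) = -ε := by ring
    rw [he] at h
    exact h
  · rw [intervalIntegrable_iff_integrableOn_Ioc_of_le hT]
    exact L.integrable_comp ((intervalIntegrable_iff_integrableOn_Ioc_of_le hT).1 (hi T hT))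
  · intro t ht
    change L (x t) = L (x 0) + _
    rw [L.intervalIntegral_comp_comm (hi t ht.1), ← map_add, ← hx.integral_eq t ht.1]
  · intro t ht
    have := norm_mulVec_add_smul_le (hA.mem t ht.1) (x t).ofLp
    rw [← Matrix.ofLp_toEuclideanCLM] at this
    exact this

theorem uniformlyExponentiallyStable_pullModes (n : ℕ) {ε : ℝ} (hε : 0 < ε) :
    UniformlyExponentiallyStable (pullModes n ε) := by
  let e := EuclideanSpace.equiv (Fin n) ℝ
  let L : State n →L[ℝ] (Fin n → ℝ) := e.toContinuousLinearMap
  let R : (Fin n → ℝ) →L[ℝ] State n := e.symm.toContinuousLinearMap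
  -- Decay holds in the sup norm; `‖R‖ * ‖L‖` is the cost of passing to the Euclidean norm, and `+
  -- 1` keeps the constant positive even for `n = 0`.
  refine ⟨‖R‖ * ‖L‖ + 1, ε, by positivity, hε, fun A Φ hA hΦ t ht => ?_⟩
  refine ContinuousLinearMap.opNorm_le_bound _ (by positivity) fun x => ?_
  have h := norm_ofLp_le_of_isSolution hε.le hA (hΦ.isSolution x) ht
  simp only [hΦ.zero_eq, map_one, one_apply_eq_self] at h
  have hR : ‖act (Φ t) x‖ ≤ ‖R‖ * ‖(act (Φ t) x).ofLp‖ := R.le_opNorm (act (Φ t) x).ofLp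
  have hL : ‖x.ofLp‖ ≤ ‖L‖ * ‖x‖ := L.le_opNorm x
  calc ‖act (Φ t) x‖ ≤ ‖R‖ * ((‖L‖ * ‖x‖) * Real.exp (-ε * t)) :=
        hR.trans (by gcongr; exact h.trans (by gcongr))
    _ ≤ (‖R‖ * ‖L‖ + 1) * Real.exp (-ε * t) * ‖x‖ := by
        have : 0 ≤ Real.exp (-ε * t) * ‖x‖ := by positivity
        linarith

/-! ### Explicit trajectories and the compactness limit -/

/-- The trajectory of the constant law `pullMatrix ε i j σ` from `x`. -/
noncomputable def pullFlow {n : ℕ} (ε : ℝ) (i j : Fin n) (σ : ℤˣ) (x : State n) (t : ℝ) :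
    State n :=
  Real.exp (-ε * t) •
    (x + ((1 - Real.exp (-t)) * (((σ : ℤ) : ℝ) * x i - x j)) • EuclideanSpace.single j (1 : ℝ))

theorem hasDerivAt_pullFlow {n : ℕ} (ε : ℝ) {i j : Fin n} (hij : i ≠ j) (σ : ℤˣ) (x : State n)
    (t : ℝ) : HasDerivAt (pullFlow ε i j σ x)
      (act (pullMatrix ε i j σ) (pullFlow ε i j σ x t)) t := by
  have h1 : HasDerivAt (fun t => Real.exp (-ε * t)) (Real.exp (-ε * t) * -ε) t := by
    simpa using ((hasDerivAt_id t).const_mul (-ε)).exp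
  have h2 : HasDerivAt (fun t => 1 - Real.exp (-t)) (Real.exp (-t)) t := by
    simpa using ((hasDerivAt_id t).neg.exp).const_sub 1
  have h3 := h1.smul (((h2.mul_const (((σ : ℤ) : ℝ) * x i - x j)).smul_const
    (EuclideanSpace.single j (1 : ℝ) : State n)).const_add x)
  refine h3.congr_deriv ?_
  ext k
  rw [act, Matrix.ofLp_toEuclideanCLM, pullMatrix_mulVec]
  by_cases hk : k = j
  · subst hk
    simp [pullFlow, hij]
    ring
  · simp [pullFlow, hk]
    ring

theorem isSolution_pullFlow {n : ℕ} (ε : ℝ) {i j : Fin n} (hij : i ≠ j) (σ : ℤˣ) (x : State n) :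
    IsSolution (fun _ => pullMatrix ε i j σ) (pullFlow ε i j σ x) := by
  have hd := hasDerivAt_pullFlow ε hij σ x
  have hc : Continuous (pullFlow ε i j σ x) :=
    continuous_iff_continuousAt.2 fun t => (hd t).continuousAt
  refine ⟨hc.continuousOn, fun t _ => ?_⟩
  rw [intervalIntegral.integral_eq_sub_of_hasDerivAt (fun s _ => hd s)
    (((act (pullMatrix ε i j σ)).continuous.comp hc).intervalIntegrable 0 t)]
  simp

theorem pullFlow_zero {n : ℕ} (ε : ℝ) (i j : Fin n) (σ : ℤˣ) (x : State n) :
    pullFlow ε i j σ x 0 = x := by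
  simp [pullFlow]

theorem IsCommonLyapunov.pullFlow_le {n : ℕ} {ε : ℝ} {V : State n → ℝ}
    (hV : IsCommonLyapunov (pullModes n ε) V) {i j : Fin n} (hij : i ≠ j) (σ : ℤˣ) (x : State n)
    {t : ℝ} (ht : 0 ≤ t) : V (pullFlow ε i j σ x t) ≤ V x := by
  by_cases hx : x = 0
  · simp [hx, pullFlow]
  have h := (hV.strictAntiOn (fun _ => pullMatrix ε i j σ) (pullFlow ε i j σ x)
    ⟨fun _ _ => measurable_const, fun _ _ => ⟨(i, j, σ), rfl⟩⟩ (isSolution_pullFlow ε hij σ x)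
    ⟨0, le_rfl, by rwa [pullFlow_zero]⟩).antitoneOn Set.self_mem_Ici ht ht
  simpa only [pullFlow_zero] using h

/-- A compact universal class contains a function which vanishes at `0` and does not increase along
the marginally stable flows with `ε = 0`. -/
theorem exists_limit_of_isUniversalClass {n : ℕ} {P : Set (State n → ℝ)}
    (hcont : ∀ V ∈ P, Continuous V) (hcompact : IsCompactFamily P) (huniv : IsUniversalClass P) :
    ∃ V ∈ P, V 0 = 0 ∧ ∀ (i j : Fin n), i ≠ j → ∀ (σ : ℤˣ) (x : State n) (t : ℝ), 0 ≤ t →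
      V (pullFlow 0 i j σ x t) ≤ V x := by
  have hpos : ∀ k : ℕ, (0 : ℝ) < 1 / ((k : ℝ) + 1) := fun k => Nat.one_div_pos_of_nat
  choose W hWP hW using fun k : ℕ => huniv _ (isBoundedSet_pullModes n (1 / ((k : ℝ) + 1)))
    (uniformlyExponentiallyStable_pullModes n (hpos k))
  let U : Ultrafilter ℕ := Ultrafilter.of atTop
  have hU : (U : Filter ℕ) ≤ atTop := Ultrafilter.of_le _
  obtain ⟨_, ⟨V, hVP, rfl⟩, hlim⟩ := isCompact_iff_ultrafilter_le_nhds.1 hcompact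
    (U.map fun k => UniformOnFun.ofFun {S : Set (State n) | Bornology.IsBounded S} (W k))
    (by
      rw [le_principal_iff]
      exact Filter.Eventually.of_forall (f := (U : Filter ℕ)) fun k => Set.mem_image_of_mem _ (hWP k))
  have hunif : ∀ S : Set (State n), Bornology.IsBounded S →
      TendstoUniformlyOn W V (U : Filter ℕ) S := fun S hS =>
    UniformOnFun.tendsto_iff_tendstoUniformlyOn.1 hlim S hS
  -- The points must be allowed to vary with `k`, because the flow itself depends on the shift.
  have hconv : ∀ {u : ℕ → State n} {x : State n}, Tendsto u U (𝓝 x) →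
      Tendsto (fun k => W k (u k)) U (𝓝 (V x)) := by
    intro u x hu
    refine (hunif (Metric.ball x 1) Metric.isBounded_ball).tendsto_comp
      (hcont V hVP).continuousWithinAt (tendsto_nhdsWithin_iff.2 ⟨hu, ?_⟩)
    exact hu.eventually (Metric.ball_mem_nhds x one_pos)
  refine ⟨V, hVP, ?_, fun i j hij σ x t ht => ?_⟩
  · have h0 := hconv (tendsto_const_nhds (x := (0 : State n)))
    simp only [(hW _).map_zero] at h0
    exact tendsto_nhds_unique h0 tendsto_const_nhds
  · have hc : Continuous fun ε : ℝ => pullFlow ε i j σ x t := by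
      unfold pullFlow
      fun_prop
    have hflow : Tendsto (fun k : ℕ => pullFlow (1 / ((k : ℝ) + 1)) i j σ x t) U
        (𝓝 (pullFlow 0 i j σ x t)) :=
      (hc.tendsto 0).comp (tendsto_one_div_add_atTop_nhds_zero_nat.mono_left hU)
    exact le_of_tendsto_of_tendsto' (hconv hflow) (hconv tendsto_const_nhds)
      fun k => (hW k).pullFlow_le hij σ x ht

/-! ### Moving one coordinate -/

/-- The point `x` with its `j`-th coordinate replaced by `s`. -/
noncomputable def setCoord {n : ℕ} (x : State n) (j : Fin n) (s : ℝ) : State n :=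
  x + (s - x j) • EuclideanSpace.single j (1 : ℝ)

theorem setCoord_apply {n : ℕ} (x : State n) (j : Fin n) (s : ℝ) (k : Fin n) :
    setCoord x j s k = if k = j then s else x k := by
  by_cases h : k = j
  · subst h; simp [setCoord]
  · simp [setCoord, h]

/-- A function that does not increase along the flows does not increase when a coordinate is moved
towards `±` another one. -/
theorem setCoord_le {n : ℕ} {V : State n → ℝ} (hc : Continuous V)
    (hV : ∀ (i j : Fin n), i ≠ j → ∀ (σ : ℤˣ) (x : State n) (t : ℝ), 0 ≤ t →
      V (pullFlow 0 i j σ x t) ≤ V x)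
    {i j : Fin n} (hij : i ≠ j) (σ : ℤˣ) (x : State n) {θ : ℝ} (h0 : 0 ≤ θ) (h1 : θ ≤ 1) :
    V (setCoord x j (x j + θ * (((σ : ℤ) : ℝ) * x i - x j))) ≤ V x := by
  have hlt : ∀ θ ∈ Set.Ico (0 : ℝ) 1,
      V (setCoord x j (x j + θ * (((σ : ℤ) : ℝ) * x i - x j))) ≤ V x := by
    intro θ hθ
    -- At this time `1 - exp (-t) = θ`. The value `θ = 1` is reached only as `t → ∞`, hence the
    -- closure argument below.
    have h := hV i j hij σ x (-Real.log (1 - θ)) (by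
      have := Real.log_nonpos (x := 1 - θ) (by linarith [hθ.2]) (by linarith [hθ.1])
      linarith)
    convert h using 2
    ext k
    rw [setCoord_apply]
    by_cases hk : k = j
    · subst hk; simp [pullFlow, Real.exp_log (by linarith [hθ.2] : 0 < 1 - θ)]
    · simp [pullFlow, hk]
  have hcθ : Continuous fun θ : ℝ =>
      V (setCoord x j (x j + θ * (((σ : ℤ) : ℝ) * x i - x j))) := by
    refine hc.comp ?_
    simp only [setCoord]
    fun_prop
  have hcl : closure (Set.Ico (0 : ℝ) 1) ⊆
      {θ | V (setCoord x j (x j + θ * (((σ : ℤ) : ℝ) * x i - x j))) ≤ V x} :=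
    (isClosed_le hcθ continuous_const).closure_subset_iff.2 hlt
  rw [closure_Ico zero_ne_one] at hcl
  exact hcl ⟨h0, h1⟩

/-- In the `(x_i, x_j)`-plane with `r = x i`, allowed moves give the cycle `(r, -r) → (r, s) → (r,
r) → (-r, r) → (-r, -r) → (r, -r)`. Since `V` never increases along it, all values agree. -/
theorem setCoord_eq_of_abs_le {n : ℕ} {V : State n → ℝ} (hc : Continuous V)
    (hV : ∀ (i j : Fin n), i ≠ j → ∀ (σ : ℤˣ) (x : State n) (t : ℝ), 0 ≤ t →
      V (pullFlow 0 i j σ x t) ≤ V x)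
    {i j : Fin n} (hij : i ≠ j) (x : State n) {s : ℝ} (hi : 0 < x i) (hs : |s| ≤ x i) :
    V (setCoord x j s) = V (setCoord x j (x i)) := by
  set r := x i with hr
  let w : ℝ → ℝ → State n := fun a b => setCoord (setCoord x i a) j b
  have hwr : ∀ b, w r b = setCoord x j b := by
    intro b
    ext k
    simp only [w, setCoord_apply, hr]
    split_ifs <;> simp_all
  have hwi : ∀ a b, w a b i = a := by
    intro a b; simp [w, setCoord_apply, hij]
  have hwj : ∀ a b, w a b j = b := by
    intro a b; simp [w, setCoord_apply]
  have hsj : ∀ a b c, setCoord (w a b) j c = w a c := by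
    intro a b c
    ext k
    simp only [w, setCoord_apply]
    split_ifs <;> simp_all
  have hsi : ∀ a b c, setCoord (w a b) i c = w c b := by
    intro a b c
    ext k
    simp only [w, setCoord_apply]
    split_ifs <;> simp_all
  have hj : ∀ (σ : ℤˣ) (a b θ : ℝ), 0 ≤ θ → θ ≤ 1 →
      V (w a (b + θ * (((σ : ℤ) : ℝ) * a - b))) ≤ V (w a b) := by
    intro σ a b θ h0 h1
    simpa only [hwi, hwj, hsj] using setCoord_le hc hV hij σ (w a b) h0 h1
  have hi' : ∀ (σ : ℤˣ) (a b θ : ℝ), 0 ≤ θ → θ ≤ 1 →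
      V (w (a + θ * (((σ : ℤ) : ℝ) * b - a)) b) ≤ V (w a b) := by
    intro σ a b θ h0 h1
    simpa only [hwi, hwj, hsi] using setCoord_le hc hV hij.symm σ (w a b) h0 h1
  obtain ⟨hs1, hs2⟩ := abs_le.1 hs
  have e1 : V (w r s) ≤ V (w r (-r)) := by
    -- The parameter solves `-r + θ * (2 * r) = s`.
    have h := hj 1 r (-r) ((s + r) / (2 * r)) (div_nonneg (by linarith) (by linarith))
      ((div_le_one (by linarith)).2 (by linarith))
    convert h using 3
    field_simp
    push_cast
    ring
  have e2 : V (w r r) ≤ V (w r s) := by simpa using hj 1 r s 1 zero_le_one le_rfl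
  have e3 : V (w (-r) r) ≤ V (w r r) := by simpa using hi' (-1) r r 1 zero_le_one le_rfl
  have e4 : V (w (-r) (-r)) ≤ V (w (-r) r) := by simpa using hj 1 (-r) r 1 zero_le_one le_rfl
  have e5 : V (w r (-r)) ≤ V (w (-r) (-r)) := by
    simpa using hi' (-1) (-r) (-r) 1 zero_le_one le_rfl
  rw [← hwr, ← hwr]
  linarith

/-! ### Analytic continuation and conclusion -/

theorem setCoord_zero_eq {n : ℕ} {V : State n → ℝ} (han : AnalyticOnNhd ℝ V Set.univ)
    (hV : ∀ (i j : Fin n), i ≠ j → ∀ (σ : ℤˣ) (x : State n) (t : ℝ), 0 ≤ t →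
      V (pullFlow 0 i j σ x t) ≤ V x)
    {i j : Fin n} (hij : i ≠ j) (x : State n) : V (setCoord x j 0) = V x := by
  have hc : Continuous V := continuousOn_univ.1 han.continuousOn
  let L : State n →L[ℝ] State n := ContinuousLinearMap.id ℝ _ -
    (EuclideanSpace.proj j).smulRight (EuclideanSpace.single j (1 : ℝ))
  have hL : ∀ y, L y = setCoord y j 0 := by
    intro y
    ext k
    rw [setCoord_apply]
    by_cases hk : k = j
    · subst hk; simp [L]
    · simp [L, hk]
  have hanL : AnalyticOnNhd ℝ (fun y => V (L y)) Set.univ :=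
    han.comp (L.analyticOnNhd _) fun _ _ => trivial
  -- The open cone `|y j| < y i` contains the `i`-th basis vector; there both `0` and `y j` are
  -- admissible values of `s` in `setCoord_eq_of_abs_le`.
  have hev : (fun y => V (L y)) =ᶠ[𝓝 (EuclideanSpace.single i (1 : ℝ) : State n)] V := by
    have hopen : IsOpen {y : State n | |y j| < y i} :=
      isOpen_lt (by fun_prop) (by fun_prop)
    filter_upwards [hopen.mem_nhds (by simp [hij.symm] : _ ∈ _)] with y hy
    have hyi : 0 < y i := (abs_nonneg _).trans_lt hy
    have h0 := setCoord_eq_of_abs_le hc hV hij y (s := 0) hyi (by simpa using hyi.le)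
    have h1 := setCoord_eq_of_abs_le hc hV hij y (s := y j) hyi (le_of_lt hy)
    rw [hL, h0, ← h1]
    simp [setCoord]
  have := congrFun (hanL.eq_of_eventuallyEq han hev) x
  simpa only [hL] using this

/-- The coordinates can be erased one at a time until the origin is reached. -/
theorem eq_zero_of_setCoord_zero_eq {n : ℕ} {V : State n → ℝ} (h0 : V 0 = 0)
    (hV : ∀ (j : Fin n) (x : State n), V (setCoord x j 0) = V x) : V = 0 := by
  have key : ∀ (s : Finset (Fin n)) (x : State n), (∀ k ∉ s, x k = 0) → V x = 0 := by
    intro s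
    induction s using Finset.induction_on with
    | empty =>
      intro x hx
      rw [show x = 0 from by ext k; exact hx k (by simp), h0]
    | insert j s _ ih =>
      intro x hx
      rw [← hV j x]
      refine ih _ fun k hk => ?_
      rw [setCoord_apply]
      split_ifs with h
      · rfl
      · exact hx k (by simp [h, hk])
  funext x
  exact key Finset.univ x fun k hk => absurd (Finset.mem_univ k) hk

end SwitchedSystem

theorem mainTheorem3 (n : ℕ) (hn : 2 ≤ n) (P : Set (SwitchedSystem.State n → ℝ))
    (hanalytic : ∀ V ∈ P, AnalyticOnNhd ℝ V Set.univ)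
    (hcompact : SwitchedSystem.IsCompactFamily P)
    (hzero : (0 : SwitchedSystem.State n → ℝ) ∉ P) :
    ¬ SwitchedSystem.IsUniversalClass P := by
  intro huniv
  obtain ⟨V, hVP, h0, hV⟩ := SwitchedSystem.exists_limit_of_isUniversalClass
    (fun V hV => continuousOn_univ.1 (hanalytic V hV).continuousOn) hcompact huniv
  have : Nontrivial (Fin n) := Fin.nontrivial_iff_two_le.2 hn
  refine hzero (SwitchedSystem.eq_zero_of_setCoord_zero_eq h0 (fun j x => ?_) ▸ hVP)
  obtain ⟨i, hij⟩ := exists_ne j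
  exact SwitchedSystem.setCoord_zero_eq (hanalytic V hVP) hV hij x
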